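/- For a finite sequence $\mathbf{k}=(k_1,\dots,k_d)$ of positive integers (possibly empty, $d\ge 0$) put $|\mathbf{k}|=k_1+\cdots+k_d$ and $$H_{M}(\mathbf{k})=\sum_{M\ge n_1>\cdots>n_d>0}\frac{1}{n_1^{k_1}\cdots n_d^{k_d}}\quad(M\ge 0),\qquad H_M(\emptyset)=1.$$ For integers $N,w\ge 1$ let $\mathrm{CMZV}_w^N\subset\mathbb{C}$ be the $\mathbb{Q}$-linear span of all colored multiple zeta values of level $N$ and weight $w$, i.e. of all sums $$\mathrm{Li}_{k_1,\dots,k_d}(\eta_1,\dots,\eta_d)=\lim_{M\to\infty}\ \sum_{M\ge n_1>\cdots>n_d>0}\frac{\eta_1^{n_1}\cdots\eta_d^{n_d}}{n_1^{k_1}\cdots n_d^{k_d}}$$ with $d\ge 1$, positive integers $k_j$ such that $k_1+\cdots+k_d=w$, and complex numbers $\eta_j$ with $\eta_j^N=1$, such that $(k_1,\eta_1)\ne(1,1)$. Corollary. Let $l\ge 2$ be an integer. For every finite (possibly empty) sequence $\mathbf{k}$ of positive integers the following series converges and $$\sum_{n\ge 1}\frac{4^n H_{n-1}(\mathbf{k})}{n^l\binom{2n}{n}}\in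 \mathrm{CMZV}^2_{|\mathbf{k}|+l}.$$ Moreover, the following series converges and $$\sum_{n\ge 0}\frac{\pi\binom{2n}{n}}{4^n(2n+1)^l}\in \mathrm{CMZV}^4_{l+1}.$$ -/

import Mathlib

/-- The multiple harmonic sum
`H_M(k₁, …, k_d) = ∑_{M ≥ n₁ > ⋯ > n_d > 0} 1 / (n₁ ^ k₁ ⋯ n_d ^ k_d)`, with `H_M(∅) = 1`,
by recursion on the depth, `n` being the largest summation variable `n₁`. -/
noncomputable def multipleHarmonicSum : ℕ → List ℕ → ℝ
  | _, [] => 1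
  | M, k :: ks => ∑ n ∈ Finset.Icc 1 M, 1 / (n : ℝ) ^ k * multipleHarmonicSum (n - 1) ks

/-- The partial sum `∑_{M ≥ n₁ > ⋯ > n_d > 0} z₁ ^ n₁ ⋯ z_d ^ n_d / (n₁ ^ k₁ ⋯ n_d ^ k_d)` of the
multiple polylogarithm `Li_{k₁, …, k_d}(z₁, …, z_d)`, where the list is
`[(k₁, z₁), …, (k_d, z_d)]`. For the empty list it is `1`. -/
noncomputable def polylogPartialSum : ℕ → List (ℕ × ℂ) → ℂ
  | _, [] => 1
  | M, (k, z) :: s => ∑ n ∈ Finset.Icc 1 M, z ^ n / (n : ℂ) ^ k * polylogPartialSum (n - 1) s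

/-- `v` is a colored multiple zeta value of level `N` and weight `w`: it is the sum, as the limit
of the partial sums over `M ≥ n₁ > ⋯ > n_d > 0`, of a series `Li_{k₁, …, k_d}(η₁, …, η_d)` with
positive integers `k_j` of sum `w`, with `N`-th roots of unity `η_j`, and with
`(k₁, η₁) ≠ (1, 1)`. (The empty list is possible only for `w = 0`.) -/
def IsCMZV (N w : ℕ) (v : ℂ) : Prop :=
  ∃ s : List (ℕ × ℂ),
    (∀ p ∈ s, 1 ≤ p.1 ∧ p.2 ^ N = 1) ∧
    (s.map Prod.fst).sum = w ∧
    s.head? ≠ some (1, 1) ∧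
    Filter.Tendsto (fun M : ℕ => polylogPartialSum M s) Filter.atTop (nhds v)

/-- The `ℚ`-linear span, inside `ℂ`, of all colored multiple zeta values of level `N` and
weight `w`. -/
noncomputable def CMZV (N w : ℕ) : Submodule ℚ ℂ :=
  Submodule.span ℚ {v : ℂ | IsCMZV N w v}

/-! Both series have the form `∑ aₙ cₙ`, where `aₙ ≥ 0` are the coefficients of a function `L(x)`
built from polylogarithms and `cₙ = ∫₀¹ φ(t)ⁿ dt/t` for a rational substitution `φ` of `(0, 1)`.
Hence the sum is `∫₀¹ L(φ(t)) dt/t`. For `φ = 4t/(1+t)²` the moments are `4ⁿ / (n binom(2n, n))`,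
and `L = Li_{l-1, k}`. For `φ = 2t/(1+t²)` the odd moments `n = 2m+1` are `(π/2) binom(2m, m) / 4ᵐ`,
and `L` is the odd part of `Li_l`.

Write `ω₀ = dt/t` and `ω_η = η dt/(1-ηt)`. `L` is an iterated integral of such forms in `x`, and `φ`
pulls them back to rational combinations of forms of the same kind: `dx/x` becomes `ω₀ + 2ω₋₁` in
the first case and `ω₀ + ω_i + ω₋ᵢ` in the second. So `L ∘ φ` is a combination of polylogarithms in
`t` of the same weight, of level 2 or 4 (`exists_polylogSpan_two_comp`,
`exists_polylogSpan_four_comp`). If `gₙ` are its coefficients, integration against `dt/t` gives `∑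
gₙ/n`, a combination of colored values of weight one higher (`tsum_div_mem_CMZV`).

The analysis rests on one condition, `∑ |gₙ|/n < ∞`: it gives convergence for `|t| < 1` and, with
the positivity of `aₙ cₙ`, the interchange of sum and integral together with the convergence of the
original series (`summable_and_tsum_eq_of_evalSeq_comp`). -/

/-! ### Coefficients of polylogarithms and their growth -/

/-- The coefficient of `t ^ n` in the multiple polylogarithm `Li_{k₁, …, k_d}(z₁ t, z₂, …, z_d)`. -/
noncomputable def coeffSeq : List (ℕ × ℂ) → ℕ → ℂ
  | [], n => if n = 0 then 1 else 0
  | (k, z) :: s, n => z ^ n / (n : ℂ) ^ k * polylogPartialSum (n - 1) s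

theorem coeffSeq_cons_zero {k : ℕ} (hk : 1 ≤ k) (z : ℂ) (s : List (ℕ × ℂ)) :
    coeffSeq ((k, z) :: s) 0 = 0 := by
  simp [coeffSeq, show k ≠ 0 by omega]

theorem sum_range_coeffSeq (s : List (ℕ × ℂ)) (hs : ∀ p ∈ s, 1 ≤ p.1) (M : ℕ) :
    ∑ n ∈ Finset.range (M + 1), coeffSeq s n = polylogPartialSum M s := by
  cases s with
  | nil => simp [coeffSeq, polylogPartialSum]
  | cons p s =>
    obtain ⟨k, z⟩ := p
    have hk : 1 ≤ k := hs (k, z) (by simp)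
    rw [Finset.sum_range_succ', coeffSeq_cons_zero hk, add_zero, polylogPartialSum,
      Finset.sum_bij (fun n _ => n + 1)]
    · intro a ha; simp at ha ⊢; omega
    · intro a _ b _ h; omega
    · intro b hb
      simp at hb
      exact ⟨b - 1, by simp; omega, by omega⟩
    · intro a _; rfl

theorem norm_polylogPartialSum_le (s : List (ℕ × ℂ)) (hs : ∀ p ∈ s, 1 ≤ p.1 ∧ ‖p.2‖ = 1) (M : ℕ) :
    ‖polylogPartialSum M s‖ ≤ (harmonic M : ℝ) ^ s.length := by
  induction s generalizing M with
  | nil => simp [polylogPartialSum]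
  | cons p s ih =>
    obtain ⟨k, z⟩ := p
    obtain ⟨hk, hz⟩ := hs (k, z) (by simp)
    have ih' := ih (fun p hp => hs p (by simp [hp]))
    rw [polylogPartialSum, List.length_cons, pow_succ', harmonic_eq_sum_Icc]
    push_cast
    rw [Finset.sum_mul]
    refine (norm_sum_le _ _).trans (Finset.sum_le_sum fun n hn => ?_)
    simp only [Finset.mem_Icc] at hn
    have hn1 : (1 : ℝ) ≤ n := by exact_mod_cast hn.1
    rw [norm_mul, norm_div, norm_pow, norm_pow, show ‖z‖ = 1 from hz, one_pow, Complex.norm_natCast]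
    have h1 : 1 / (n : ℝ) ^ k ≤ (n : ℝ)⁻¹ := by
      rw [one_div]
      exact inv_anti₀ (by linarith) (le_self_pow₀ hn1 (by omega))
    have h2 : (harmonic (n - 1) : ℝ) ≤ ∑ i ∈ Finset.Icc 1 M, (i : ℝ)⁻¹ := by
      rw [harmonic_eq_sum_Icc]
      push_cast
      exact Finset.sum_le_sum_of_subset_of_nonneg (Finset.Icc_subset_Icc_right (by omega))
        fun _ _ _ => by positivity
    have h0 : (0 : ℝ) ≤ harmonic (n - 1) := by
      rw [harmonic_eq_sum_Icc]; push_cast; positivity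
    exact mul_le_mul h1 ((ih' _).trans (pow_le_pow_left₀ h0 h2 _)) (norm_nonneg _) (by positivity)

theorem harmonic_pow_le_sqrt (d : ℕ) :
    ∃ C : ℝ, ∀ n : ℕ, 1 ≤ n → (harmonic n : ℝ) ^ d ≤ C * (n : ℝ) ^ (1 / 2 : ℝ) := by
  -- `H_n` is `O(n^ε)` for every `ε > 0`; this choice makes `ε * d ≤ 1/2`, also for `d = 0`.
  set ε : ℝ := 1 / (2 * (d + 1)) with hε
  have hε0 : 0 < ε := by positivity
  refine ⟨(1 + 1 / ε) ^ d, fun n hn => ?_⟩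
  have hn1 : (1 : ℝ) ≤ n := by exact_mod_cast hn
  have h0 : (0 : ℝ) ≤ harmonic n := by
    rw [harmonic_eq_sum_Icc]; push_cast; positivity
  have h1 : (harmonic n : ℝ) ≤ (1 + 1 / ε) * (n : ℝ) ^ ε := by
    have h2 := Real.log_le_rpow_div (by linarith : (0 : ℝ) ≤ n) hε0
    have h3 := Real.one_le_rpow hn1 hε0.le
    have h4 := harmonic_le_one_add_log n
    have h5 : (1 + 1 / ε) * (n : ℝ) ^ ε = (n : ℝ) ^ ε + (n : ℝ) ^ ε / ε := by ring
    linarith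
  calc (harmonic n : ℝ) ^ d ≤ ((1 + 1 / ε) * (n : ℝ) ^ ε) ^ d := pow_le_pow_left₀ h0 h1 _
    _ = (1 + 1 / ε) ^ d * (n : ℝ) ^ (ε * d) := by
      rw [mul_pow, Real.rpow_mul (by linarith), Real.rpow_natCast]
    _ ≤ _ := by
      have h6 : ε * d ≤ 1 / 2 := by
        rw [hε, div_mul_eq_mul_div, one_mul, div_le_div_iff₀ (by positivity) (by norm_num)]
        linarith
      exact mul_le_mul_of_nonneg_left (Real.rpow_le_rpow_of_exponent_le hn1 h6) (by positivity)

/-- The nested sum is at most a power of a harmonic number, hence `O(√n)`, so the terms are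
`O(n^(-3/2))`. For the empty word only `n = 0` could contribute, and there division by zero gives
`0`. -/
theorem summable_norm_coeffSeq_div (s : List (ℕ × ℂ)) (hs : ∀ p ∈ s, 1 ≤ p.1 ∧ ‖p.2‖ = 1) :
    Summable fun n : ℕ => ‖coeffSeq s n‖ / n := by
  cases s with
  | nil =>
    refine summable_of_ne_finset_zero (s := ∅) fun n _ => ?_
    rcases eq_or_ne n 0 with rfl | h <;> simp [coeffSeq, *]
  | cons p s =>
    obtain ⟨k, z⟩ := p
    obtain ⟨hk, hz⟩ := hs (k, z) (by simp)
    have hs' : ∀ p ∈ s, 1 ≤ p.1 ∧ ‖p.2‖ = 1 := fun p hp => hs p (by simp [hp])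
    obtain ⟨C, hC⟩ := harmonic_pow_le_sqrt s.length
    have hsum : Summable fun n : ℕ => C * (1 / (n : ℝ) ^ (3 / 2 : ℝ)) :=
      (Real.summable_one_div_nat_rpow.2 (by norm_num)).mul_left C
    refine Summable.of_nonneg_of_le (fun n => by positivity) (fun n => ?_) hsum
    rcases Nat.eq_zero_or_pos n with rfl | hn
    · simp [Real.zero_rpow]
    have hn1 : (1 : ℝ) ≤ n := by exact_mod_cast hn
    have hn0 : (0 : ℝ) < n := by linarith
    rw [coeffSeq, norm_mul, norm_div, norm_pow, norm_pow, show ‖z‖ = 1 from hz, one_pow,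
      Complex.norm_natCast]
    have h1 : 1 / (n : ℝ) ^ k ≤ (n : ℝ)⁻¹ := by
      rw [one_div]
      exact inv_anti₀ hn0 (le_self_pow₀ hn1 (by omega))
    have h0 : (0 : ℝ) ≤ harmonic (n - 1) := by
      rw [harmonic_eq_sum_Icc]; push_cast; positivity
    have h2 : (harmonic (n - 1) : ℝ) ≤ harmonic n := by
      simp only [harmonic_eq_sum_Icc]
      push_cast
      exact Finset.sum_le_sum_of_subset_of_nonneg (Finset.Icc_subset_Icc_right (by omega))
        fun _ _ _ => by positivity
    have h3 : ‖polylogPartialSum (n - 1) s‖ ≤ C * (n : ℝ) ^ (1 / 2 : ℝ) :=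
      (norm_polylogPartialSum_le s hs' _).trans ((pow_le_pow_left₀ h0 h2 _).trans (hC n hn))
    have h4 : (n : ℝ) ^ (3 / 2 : ℝ) * (n : ℝ) ^ (1 / 2 : ℝ) = n * n := by
      rw [← Real.rpow_add hn0, show (3 / 2 + 1 / 2 : ℝ) = (2 : ℕ) by norm_num, Real.rpow_natCast, sq]
    calc 1 / (n : ℝ) ^ k * ‖polylogPartialSum (n - 1) s‖ / n
        ≤ (n : ℝ)⁻¹ * (C * (n : ℝ) ^ (1 / 2 : ℝ)) / n := by gcongr
      _ = C * ((n : ℝ) ^ (1 / 2 : ℝ) / (n * n)) := by field_simp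
      _ = C * (1 / (n : ℝ) ^ (3 / 2 : ℝ)) := by
        rw [← h4]
        congr 1
        field_simp

/-! ### Iterated integration on coefficient sequences -/

/-- The `ℚ`-span of the coefficient sequences of multiple polylogarithms of weight `w` at `N`-th roots
of unity. -/
noncomputable def polylogSpan (N w : ℕ) : Submodule ℚ (ℕ → ℂ) :=
  Submodule.span ℚ {g | ∃ s : List (ℕ × ℂ), (∀ p ∈ s, 1 ≤ p.1 ∧ p.2 ^ N = 1) ∧
    (s.map Prod.fst).sum = w ∧ g = coeffSeq s}

theorem coeffSeq_mem_polylogSpan {N : ℕ} (s : List (ℕ × ℂ)) (hs : ∀ p ∈ s, 1 ≤ p.1 ∧ p.2 ^ N = 1) :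
    coeffSeq s ∈ polylogSpan N (s.map Prod.fst).sum :=
  Submodule.subset_span ⟨s, hs, rfl, rfl⟩

/-- The operation `∫ f dt / t` on coefficient sequences. -/
noncomputable def integrateZero : (ℕ → ℂ) →ₗ[ℚ] (ℕ → ℂ) where
  toFun g n := g n / n
  map_add' g h := by ext n; simp [add_div]
  map_smul' c g := by ext n; simp [Algebra.smul_def, mul_div_assoc]

/-- The operation `∫ f η dt / (1 - η t)` on coefficient sequences. -/
noncomputable def integrateAt (η : ℂ) : (ℕ → ℂ) →ₗ[ℚ] (ℕ → ℂ) where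
  toFun g n := (∑ m ∈ Finset.range n, η ^ (n - m) * g m) / n
  map_add' g h := by ext n; simp [mul_add, Finset.sum_add_distrib, add_div]
  map_smul' c g := by
    ext n
    simp only [Pi.smul_apply, Algebra.smul_def, RingHom.id_apply]
    rw [← mul_div_assoc, Finset.mul_sum]
    congr 1
    exact Finset.sum_congr rfl fun _ _ => by ring

theorem integrateZero_coeffSeq (k : ℕ) (z : ℂ) (s : List (ℕ × ℂ)) :
    integrateZero (coeffSeq ((k, z) :: s)) = coeffSeq ((k + 1, z) :: s) := by
  ext n
  simp only [integrateZero, LinearMap.coe_mk, AddHom.coe_mk, coeffSeq, pow_succ]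
  ring

/-- The convention `1 / 0 = 0` discards the constant term, whose integral against `dt / t` would
diverge. -/
theorem integrateZero_nil : integrateZero (coeffSeq []) = 0 := by
  ext n
  rcases eq_or_ne n 0 with rfl | h <;> simp [integrateZero, coeffSeq, *]

theorem integrateAt_nil (η : ℂ) : integrateAt η (coeffSeq []) = coeffSeq [(1, η)] := by
  ext n
  rcases eq_or_ne n 0 with rfl | h
  · simp [integrateAt, coeffSeq]
  · simp [integrateAt, coeffSeq, polylogPartialSum, h]

/-- Since `η ^ (n - m) = η ^ n * η' ^ m`, the convolution splits: `η` becomes the root of a new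
leading letter and the former leading root is twisted by `η' = η⁻¹`. -/
theorem integrateAt_cons {η η' : ℂ} (hη : η' * η = 1) {k : ℕ} (hk : 1 ≤ k) (z : ℂ)
    (s : List (ℕ × ℂ)) (hs : ∀ p ∈ s, 1 ≤ p.1) :
    integrateAt η (coeffSeq ((k, z) :: s)) = coeffSeq ((1, η) :: (k, z * η') :: s) := by
  ext n
  rcases Nat.eq_zero_or_pos n with rfl | h
  · simp [integrateAt, coeffSeq]
  have hs' : ∀ p ∈ ((k, z * η') :: s : List (ℕ × ℂ)), 1 ≤ p.1 := by
    intro p hp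
    rcases List.mem_cons.1 hp with rfl | hp
    · exact hk
    · exact hs p hp
  simp only [integrateAt, LinearMap.coe_mk, AddHom.coe_mk]
  rw [coeffSeq.eq_2 n 1 η, ← sum_range_coeffSeq _ hs', Nat.sub_add_cancel h, pow_one,
    div_mul_eq_mul_div, Finset.mul_sum]
  congr 1
  refine Finset.sum_congr rfl fun m hm => ?_
  have hm' := Finset.mem_range.1 hm
  have h1 : η ^ n * η' ^ m = η ^ (n - m) := by
    rw [← Nat.sub_add_cancel hm'.le, pow_add, Nat.add_sub_cancel, mul_assoc, ← mul_pow,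
      mul_comm η, hη, one_pow, mul_one]
  rw [coeffSeq, coeffSeq, mul_pow, ← h1]
  ring

theorem integrateZero_mem {N w : ℕ} {g : ℕ → ℂ} (hg : g ∈ polylogSpan N w) :
    integrateZero g ∈ polylogSpan N (w + 1) := by
  refine Submodule.span_le (p := (polylogSpan N (w + 1)).comap integrateZero) |>.2 ?_ hg
  rintro _ ⟨s, hs, rfl, rfl⟩
  rw [SetLike.mem_coe, Submodule.mem_comap]
  cases s with
  | nil => rw [integrateZero_nil]; exact zero_mem _
  | cons p s =>
    obtain ⟨k, z⟩ := p
    rw [integrateZero_coeffSeq]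
    have := coeffSeq_mem_polylogSpan (N := N) ((k + 1, z) :: s) (by
      intro p hp
      rcases List.mem_cons.1 hp with rfl | hp
      · exact ⟨by simp, (hs (k, z) (by simp)).2⟩
      · exact hs p (by simp [hp]))
    convert this using 1
    simp
    ring_nf

theorem integrateAt_mem {N w : ℕ} (hN : N ≠ 0) {η : ℂ} (hη : η ^ N = 1) {g : ℕ → ℂ}
    (hg : g ∈ polylogSpan N w) : integrateAt η g ∈ polylogSpan N (w + 1) := by
  refine Submodule.span_le (p := (polylogSpan N (w + 1)).comap (integrateAt η)) |>.2 ?_ hg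
  rintro _ ⟨s, hs, rfl, rfl⟩
  rw [SetLike.mem_coe, Submodule.mem_comap]
  cases s with
  | nil =>
    rw [integrateAt_nil]
    exact coeffSeq_mem_polylogSpan [(1, η)] (by simpa using hη)
  | cons p s =>
    obtain ⟨k, z⟩ := p
    have hkz := hs (k, z) (by simp)
    have h0 : η⁻¹ * η = 1 := inv_mul_cancel₀ (by rintro rfl; simp [hN] at hη)
    rw [integrateAt_cons h0 hkz.1 z s fun p hp => (hs p (by simp [hp])).1]
    have := coeffSeq_mem_polylogSpan (N := N) ((1, η) :: (k, z * η⁻¹) :: s) (by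
      intro p hp
      rcases List.mem_cons.1 hp with rfl | hp
      · exact ⟨le_rfl, hη⟩
      rcases List.mem_cons.1 hp with rfl | hp
      · exact ⟨hkz.1, by
          rw [show (k, z * η⁻¹).2 = z * η⁻¹ from rfl, mul_pow, inv_pow, hη, hkz.2]; simp⟩
      · exact hs p (by simp [hp]))
    convert this using 1
    simp
    ring_nf

theorem summable_norm_div_of_mem {N w : ℕ} (hN : N ≠ 0) {g : ℕ → ℂ} (hg : g ∈ polylogSpan N w) :
    Summable fun n : ℕ => ‖g n‖ / n := by
  induction hg using Submodule.span_induction with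
  | mem g hg =>
    obtain ⟨s, hs, -, rfl⟩ := hg
    exact summable_norm_coeffSeq_div s fun p hp =>
      ⟨(hs p hp).1, Complex.norm_eq_one_of_pow_eq_one (hs p hp).2 hN⟩
  | zero => simp
  | add g h _ _ h1 h2 =>
    refine Summable.of_nonneg_of_le (fun n => by positivity) (fun n => ?_) (h1.add h2)
    rw [← add_div]
    gcongr
    exact norm_add_le _ _
  | smul c g _ h =>
    refine (h.mul_left ‖(c : ℂ)‖).congr fun n => ?_
    rw [Pi.smul_apply, Algebra.smul_def, norm_mul, mul_div_assoc]
    rfl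

theorem apply_zero_of_mem {N w : ℕ} {g : ℕ → ℂ} (hg : g ∈ polylogSpan N (w + 1)) : g 0 = 0 := by
  induction hg using Submodule.span_induction with
  | mem g hg =>
    obtain ⟨s, hs, hw, rfl⟩ := hg
    cases s with
    | nil => simp at hw
    | cons p s => exact coeffSeq_cons_zero (hs p (by simp)).1 _ _
  | zero => rfl
  | add g h _ _ h1 h2 => simp [h1, h2]
  | smul c g _ h => simp [h]

/-- Division by `n` raises the leading exponent to at least `2`, so the excluded pair `(1, 1)`
cannot lead. Positive weight rules out the empty word. -/
theorem tsum_div_mem_CMZV {N w : ℕ} (hN : N ≠ 0) {g : ℕ → ℂ} (hg : g ∈ polylogSpan N (w + 1)) :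
    ∑' n : ℕ, g n / n ∈ CMZV N (w + 2) := by
  have hsum : ∀ {g : ℕ → ℂ}, g ∈ polylogSpan N (w + 1) → Summable fun n : ℕ => g n / n := fun hg =>
    Summable.of_norm (by simpa using summable_norm_div_of_mem hN hg)
  induction hg using Submodule.span_induction with
  | mem g hg =>
    have hg' := hsum (Submodule.subset_span hg)
    obtain ⟨s, hs, hw, rfl⟩ := hg
    cases s with
    | nil => simp at hw
    | cons p s =>
      obtain ⟨k, z⟩ := p
      have hk : 1 ≤ k := (hs (k, z) (by simp)).1
      have hs' : ∀ p ∈ ((k + 1, z) :: s : List (ℕ × ℂ)), 1 ≤ p.1 ∧ p.2 ^ N = 1 := by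
        intro p hp
        rcases List.mem_cons.1 hp with rfl | hp
        · exact ⟨by simp, (hs (k, z) (by simp)).2⟩
        · exact hs p (by simp [hp])
      refine Submodule.subset_span ⟨(k + 1, z) :: s, hs', ?_, ?_, ?_⟩
      · simp at hw ⊢
        omega
      · simp
        omega
      · have := (hg'.hasSum.tendsto_sum_nat).comp (Filter.tendsto_add_atTop_nat 1)
        refine this.congr fun M => ?_
        rw [← sum_range_coeffSeq _ (fun p hp => (hs' p hp).1), ← integrateZero_coeffSeq]
        rfl
  | zero => simp
  | add g h hg hh h1 h2 =>
    have := (hsum hg).tsum_add (hsum hh)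
    simp only [Pi.add_apply, add_div]
    rw [this]
    exact add_mem h1 h2
  | smul c g hg h =>
    have : ∑' n : ℕ, (c • g) n / (n : ℂ) = c • ∑' n : ℕ, g n / n := by
      rw [Algebra.smul_def (A := ℂ), ← tsum_mul_left]
      exact tsum_congr fun n => by rw [Pi.smul_apply, Algebra.smul_def, mul_div_assoc]
    rw [this]
    exact Submodule.smul_mem _ _ h

/-! ### Power series on the unit interval and their differential equations -/

/-- The sum of the power series with coefficients `g` at a real number `t`. -/
noncomputable def evalSeq (g : ℕ → ℂ) (t : ℝ) : ℂ := ∑' n : ℕ, g n * (t : ℂ) ^ n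

theorem norm_le_mul_of_summable_div {g : ℕ → ℂ} (hg : Summable fun n : ℕ => ‖g n‖ / n) (n : ℕ)
    (hn : n ≠ 0) : ‖g n‖ ≤ (∑' n : ℕ, ‖g n‖ / n) * n := by
  have h := hg.le_tsum n fun j _ => by positivity
  rwa [div_le_iff₀ (by positivity)] at h

theorem summable_norm_mul_natCast_mul_pow {g : ℕ → ℂ} (hg : Summable fun n : ℕ => ‖g n‖ / n) {r : ℝ}
    (h0 : 0 ≤ r) (h1 : r < 1) : Summable fun n : ℕ => ‖g n‖ * n * r ^ n := by
  have := (summable_pow_mul_geometric_of_norm_lt_one 2 (r := r)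
    (by rwa [Real.norm_of_nonneg h0])).mul_left (∑' n : ℕ, ‖g n‖ / n)
  refine Summable.of_nonneg_of_le (fun n => by positivity) (fun n => ?_) this
  rcases eq_or_ne n 0 with rfl | hn
  · simp
  calc ‖g n‖ * n * r ^ n ≤ ((∑' n : ℕ, ‖g n‖ / n) * n) * n * r ^ n := by
        gcongr; exact norm_le_mul_of_summable_div hg n hn
    _ = _ := by ring

theorem summable_norm_mul_pow {g : ℕ → ℂ} (hg : Summable fun n : ℕ => ‖g n‖ / n) {r : ℝ}
    (h0 : 0 ≤ r) (h1 : r < 1) : Summable fun n : ℕ => ‖g n‖ * r ^ n := by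
  rw [← summable_nat_add_iff 1]
  refine Summable.of_nonneg_of_le (fun n => by positivity) (fun n => ?_)
    ((summable_nat_add_iff 1).2 (summable_norm_mul_natCast_mul_pow hg h0 h1))
  gcongr
  refine le_mul_of_one_le_right (norm_nonneg _) ?_
  push_cast
  linarith [Nat.cast_nonneg (α := ℝ) n]

theorem summable_evalSeq {g : ℕ → ℂ} (hg : Summable fun n : ℕ => ‖g n‖ / n) {t : ℝ}
    (h0 : 0 ≤ t) (h1 : t < 1) : Summable fun n : ℕ => g n * (t : ℂ) ^ n := by
  refine Summable.of_norm ((summable_norm_mul_pow hg h0 h1).congr fun n => ?_)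
  rw [norm_mul, norm_pow, Complex.norm_real, Real.norm_of_nonneg h0]

theorem summable_evalSeq_natCast_mul {g : ℕ → ℂ} (hg : Summable fun n : ℕ => ‖g n‖ / n) {t : ℝ}
    (h0 : 0 ≤ t) (h1 : t < 1) : Summable fun n : ℕ => n * g n * (t : ℂ) ^ n := by
  refine Summable.of_norm ((summable_norm_mul_natCast_mul_pow hg h0 h1).congr fun n => ?_)
  rw [norm_mul, norm_mul, norm_pow, Complex.norm_real, Real.norm_of_nonneg h0, Complex.norm_natCast]
  ring

theorem hasDerivAt_evalSeq {g : ℕ → ℂ} (hg : Summable fun n : ℕ => ‖g n‖ / n) {t : ℝ}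
    (ht : |t| < 1) : HasDerivAt (evalSeq g) (∑' n : ℕ, g n * (n * (t : ℂ) ^ (n - 1))) t := by
  obtain ⟨r, hr, hr1⟩ := exists_between ht
  have hr0 : 0 < r := (abs_nonneg t).trans_lt hr
  have hsum : Summable fun n : ℕ => ‖g n‖ * (n * r ^ (n - 1)) := by
    refine ((summable_norm_mul_natCast_mul_pow hg hr0.le hr1).mul_right r⁻¹).congr fun n => ?_
    cases n with
    | zero => simp
    | succ n => rw [Nat.add_sub_cancel, pow_succ]; field_simp
  refine hasDerivAt_tsum_of_isPreconnected (g := fun n (y : ℝ) => g n * (y : ℂ) ^ n)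
    (g' := fun n (y : ℝ) => g n * (n * (y : ℂ) ^ (n - 1))) (t := Set.Ioo (-r) r) (y₀ := 0) hsum isOpen_Ioo
    isPreconnected_Ioo (fun n y _ => ?_) (fun n y hy => ?_) ⟨by linarith, hr0⟩ ?_ (abs_lt.1 hr)
  · have := ((hasDerivAt_pow n (y : ℂ)).comp_ofReal).const_mul (g n)
    exact this
  · rw [norm_mul, norm_mul, norm_pow, Complex.norm_real, Complex.norm_natCast]
    gcongr
    exact (abs_lt.2 hy).le
  · exact summable_evalSeq hg le_rfl one_pos

theorem hasDerivAt_evalSeq_div {g : ℕ → ℂ} (hg : Summable fun n : ℕ => ‖g n‖ / n) {t : ℝ}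
    (h0 : 0 < t) (h1 : t < 1) :
    HasDerivAt (evalSeq g) (evalSeq (fun n => n * g n) t / t) t := by
  convert hasDerivAt_evalSeq hg (abs_lt.2 ⟨by linarith, h1⟩) using 1
  have ht : (t : ℂ) ≠ 0 := by exact_mod_cast h0.ne'
  rw [evalSeq, ← tsum_div_const]
  refine tsum_congr fun n => ?_
  cases n with
  | zero => simp
  | succ n => rw [Nat.add_sub_cancel, pow_succ]; field_simp

theorem evalSeq_zero (g : ℕ → ℂ) : evalSeq g 0 = g 0 := by
  rw [evalSeq, tsum_eq_single 0]
  · simp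
  · intro n hn; simp [hn]

theorem evalSeq_natCast_mul_add {g h : ℕ → ℂ} (hg : Summable fun n : ℕ => ‖g n‖ / n)
    (hh : Summable fun n : ℕ => ‖h n‖ / n) {t : ℝ} (h0 : 0 ≤ t) (h1 : t < 1) :
    evalSeq (fun n => n * (g + h) n) t =
      evalSeq (fun n => n * g n) t + evalSeq (fun n => n * h n) t := by
  rw [evalSeq, evalSeq, evalSeq,
    ← (summable_evalSeq_natCast_mul hg h0 h1).tsum_add (summable_evalSeq_natCast_mul hh h0 h1)]
  exact tsum_congr fun n => by rw [Pi.add_apply]; ring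

theorem evalSeq_natCast_mul_smul (c : ℚ) (g : ℕ → ℂ) (t : ℝ) :
    evalSeq (fun n => n * (c • g) n) t = c * evalSeq (fun n => n * g n) t := by
  rw [evalSeq, evalSeq, ← tsum_mul_left]
  refine tsum_congr fun n => ?_
  rw [Pi.smul_apply, Algebra.smul_def, eq_ratCast]
  ring

theorem evalSeq_natCast_mul_integrateZero {g : ℕ → ℂ} (hg0 : g 0 = 0) (t : ℝ) :
    evalSeq (fun n => n * integrateZero g n) t = evalSeq g t := by
  refine tsum_congr fun n => ?_
  rcases eq_or_ne n 0 with rfl | hn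
  · simp [hg0]
  · have : (n : ℂ) ≠ 0 := by exact_mod_cast hn
    simp only [integrateZero, LinearMap.coe_mk, AddHom.coe_mk]
    field_simp

theorem evalSeq_natCast_mul_integrateAt {g : ℕ → ℂ} (hg : Summable fun n : ℕ => ‖g n‖ / n) {η : ℂ}
    (hη : ‖η‖ = 1) (hi : Summable fun n : ℕ => ‖integrateAt η g n‖ / n) {t : ℝ} (h0 : 0 ≤ t)
    (h1 : t < 1) :
    evalSeq (fun n => n * integrateAt η g n) t = η * t / (1 - η * t) * evalSeq g t := by
  have hne : 1 - η * t ≠ 0 := by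
    intro h
    have h2 : ‖η * t‖ = 1 := by rw [← sub_eq_zero.1 h, norm_one]
    rw [norm_mul, hη, Complex.norm_real, Real.norm_of_nonneg h0] at h2
    linarith
  -- Passing from `n` to `n + 1` multiplies the convolution by `η` and adds one term. Summed against
  -- `t ^ (n + 1)`, this gives `F = η t F + η t G`, which is solved for `F`.
  have hstep : ∀ n : ℕ, ((n + 1 : ℕ) : ℂ) * integrateAt η g (n + 1) =
      η * (n * integrateAt η g n) + η * g n := by
    intro n
    have hn1 : ((n + 1 : ℕ) : ℂ) ≠ 0 := by exact_mod_cast n.succ_ne_zero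
    have hmul : ∀ n : ℕ, (n : ℂ) * integrateAt η g n = ∑ m ∈ Finset.range n, η ^ (n - m) * g m := by
      intro n
      rcases eq_or_ne n 0 with rfl | hn
      · simp
      · have : (n : ℂ) ≠ 0 := by exact_mod_cast hn
        simp only [integrateAt, LinearMap.coe_mk, AddHom.coe_mk]
        field_simp
    rw [hmul, hmul, Finset.sum_range_succ, Finset.mul_sum, Nat.add_sub_cancel_left, pow_one]
    congr 1
    refine Finset.sum_congr rfl fun m hm => ?_
    rw [Nat.succ_sub (Finset.mem_range.1 hm).le, pow_succ]
    ring
  have hs := summable_evalSeq_natCast_mul hi h0 h1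
  have key : evalSeq (fun n => n * integrateAt η g n) t =
      η * t * evalSeq (fun n => n * integrateAt η g n) t + η * t * evalSeq g t := by
    conv_lhs => rw [evalSeq, hs.tsum_eq_zero_add]
    rw [evalSeq, evalSeq, ← tsum_mul_left, ← tsum_mul_left,
      ← (hs.mul_left _).tsum_add ((summable_evalSeq hg h0 h1).mul_left _)]
    simp only [Nat.cast_zero, zero_mul, zero_add]
    refine tsum_congr fun n => ?_
    rw [hstep, pow_succ]
    ring
  rw [div_mul_eq_mul_div, eq_div_iff hne]
  linear_combination key

/-! ### Changes of variables -/

/-- A change of variables `φ` of the interval `(0, 1)` with `φ(0+) = 0` and logarithmic derivative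
`t φ' / φ = E`. -/
structure IsChangeOfVariables (φ E : ℝ → ℝ) : Prop where
  mem_Ioo : ∀ t ∈ Set.Ioo (0 : ℝ) 1, φ t ∈ Set.Ioo (0 : ℝ) 1
  tendsto : Filter.Tendsto φ (nhdsWithin 0 (Set.Ioi 0)) (nhds 0)
  hasDerivAt : ∀ t ∈ Set.Ioo (0 : ℝ) 1, HasDerivAt φ (φ t * E t / t) t

/-- Multiplying coefficients by `n` is the operator `t d/dt`, so `hD` says by the chain rule that
both sides have the same derivative; their difference is constant and tends to `a 0 - g 0 = 0` at
`0+`. -/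
theorem IsChangeOfVariables.evalSeq_comp {φ E : ℝ → ℝ} (hφ : IsChangeOfVariables φ E) {a g : ℕ → ℂ}
    (ha : Summable fun n : ℕ => ‖a n‖ / n) (hg : Summable fun n : ℕ => ‖g n‖ / n)
    (h0 : a 0 = g 0)
    (hD : ∀ t ∈ Set.Ioo (0 : ℝ) 1,
      E t * evalSeq (fun n => n * a n) (φ t) = evalSeq (fun n => n * g n) t) :
    ∀ t ∈ Set.Ioo (0 : ℝ) 1, evalSeq a (φ t) = evalSeq g t := by
  have hderiv : ∀ t ∈ Set.Ioo (0 : ℝ) 1,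
      HasDerivAt (fun t => evalSeq a (φ t) - evalSeq g t) 0 t := by
    intro t ht
    obtain ⟨hp0, hp1⟩ := hφ.mem_Ioo t ht
    have hd1 := (hasDerivAt_evalSeq_div ha hp0 hp1).scomp t (hφ.hasDerivAt t ht)
    have hd2 := hasDerivAt_evalSeq_div hg ht.1 ht.2
    refine (hd1.sub hd2).congr_deriv ?_
    rw [← hD t ht, Complex.real_smul]
    have hp : (φ t : ℂ) ≠ 0 := by exact_mod_cast hp0.ne'
    have ht' : (t : ℂ) ≠ 0 := by exact_mod_cast ht.1.ne'
    push_cast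
    field_simp
    ring
  obtain ⟨c, hc⟩ := IsOpen.exists_is_const_of_deriv_eq_zero isOpen_Ioo isPreconnected_Ioo
    (fun t ht => (hderiv t ht).differentiableAt.differentiableWithinAt)
    (fun t ht => (hderiv t ht).deriv)
  have hc0 : c = 0 := by
    have t1 : Filter.Tendsto (fun t => evalSeq a (φ t) - evalSeq g t)
        (nhdsWithin 0 (Set.Ioi 0)) (nhds 0) := by
      have e1 := (hasDerivAt_evalSeq ha (t := 0) (by simp)).continuousAt.tendsto.comp hφ.tendsto
      have e2 := (hasDerivAt_evalSeq hg (t := 0) (by simp)).continuousAt.tendsto.mono_left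
        (nhdsWithin_le_nhds (s := Set.Ioi 0))
      have := e1.sub e2
      rwa [evalSeq_zero, evalSeq_zero, h0, sub_self] at this
    refine tendsto_nhds_unique ?_ t1
    refine tendsto_const_nhds.congr' ?_
    filter_upwards [Ioo_mem_nhdsGT (zero_lt_one' ℝ)] with t ht
    exact (hc t ht).symm
  intro t ht
  rw [← sub_eq_zero]
  exact (hc t ht).trans hc0

/-! ### Integration against `dt / t` -/

-- Integrate `∑ aₙ φⁿ / t = ∑ gₙ₊₁ tⁿ` termwise over `(0, 1)`. The moments are required only where
-- `a n ≠ 0`: for `n = 0` the integrand `1 / t` is not integrable, and in the second application the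
-- closed form is needed for odd `n` only.
open MeasureTheory in
theorem summable_and_tsum_eq_of_evalSeq_comp {φ : ℝ → ℝ} (hφ : ∀ t ∈ Set.Ioo (0 : ℝ) 1,
    φ t ∈ Set.Ioo (0 : ℝ) 1) {a c : ℕ → ℝ} {g : ℕ → ℂ} (ha : ∀ n, 0 ≤ a n)
    (has : Summable fun n : ℕ => ‖(a n : ℂ)‖ / n) (hg : Summable fun n : ℕ => ‖g n‖ / n)
    (hg0 : g 0 = 0)
    (h : ∀ t ∈ Set.Ioo (0 : ℝ) 1, evalSeq (fun n => (a n : ℂ)) (φ t) = evalSeq g t)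
    (hc : ∀ n, a n ≠ 0 → IntegrableOn (fun t => φ t ^ n / t) (Set.Ioo 0 1) ∧
      ∫ t in Set.Ioo (0 : ℝ) 1, φ t ^ n / t = c n) :
    (Summable fun n => a n * c n) ∧ ((∑' n, a n * c n : ℝ) : ℂ) = ∑' n : ℕ, g n / n := by
  set μ : Measure ℝ := volume.restrict (Set.Ioo 0 1) with hμ
  have hmem : ∀ᵐ t ∂μ, t ∈ Set.Ioo (0 : ℝ) 1 := ae_restrict_mem measurableSet_Ioo
  have hfi : ∀ n, Integrable (fun t => a n * (φ t ^ n / t)) μ := by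
    intro n
    rcases eq_or_ne (a n) 0 with h0 | h0
    · simp [h0]
    · exact (hc n h0).1.const_mul _
  have hfc : ∀ n, ∫ t, a n * (φ t ^ n / t) ∂μ = a n * c n := by
    intro n
    rcases eq_or_ne (a n) 0 with h0 | h0
    · simp [h0]
    · rw [integral_const_mul, (hc n h0).2]
  have hf0 : ∀ n, ∀ t ∈ Set.Ioo (0 : ℝ) 1, 0 ≤ a n * (φ t ^ n / t) := fun n t ht =>
    mul_nonneg (ha n) (div_nonneg (pow_nonneg (hφ t ht).1.le _) ht.1.le)
  have hf0' : ∀ n, 0 ≤ᵐ[μ] fun t => a n * (φ t ^ n / t) := fun n => by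
    filter_upwards [hmem] with t ht using hf0 n t ht
  have hac0 : ∀ n, 0 ≤ a n * c n := fun n => by
    rw [← hfc]; exact integral_nonneg_of_ae (hf0' n)
  have hpow : ∀ n : ℕ, ∫ t, t ^ n ∂μ = 1 / (n + 1) := by
    intro n
    rw [hμ, ← integral_Ioc_eq_integral_Ioo, ← intervalIntegral.integral_of_le zero_le_one,
      integral_pow]
    simp
  have hpowi : ∀ n : ℕ, Integrable (fun t : ℝ => t ^ n) μ := fun n =>
    ((continuous_pow n).integrableOn_Icc (a := 0) (b := 1)).mono_set Set.Ioo_subset_Icc_self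
  have hFi : ∀ n : ℕ, Integrable (fun t : ℝ => g (n + 1) * (t : ℂ) ^ n) μ := fun n => by
    have := (hpowi n).ofReal (𝕜 := ℂ)
    simpa using this.const_mul (g (n + 1))
  have hFc : ∀ n : ℕ, ∫ t : ℝ, g (n + 1) * (t : ℂ) ^ n ∂μ = g (n + 1) / (n + 1 : ℕ) := fun n => by
    rw [integral_const_mul]
    have : ∫ t : ℝ, (t : ℂ) ^ n ∂μ = ((∫ t : ℝ, t ^ n ∂μ : ℝ) : ℂ) := by
      rw [← integral_complex_ofReal]; simp
    rw [this, hpow]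
    push_cast
    ring
  have hFn : ∀ n : ℕ, ∫ t : ℝ, ‖g (n + 1) * (t : ℂ) ^ n‖ ∂μ = ‖g (n + 1)‖ / (n + 1 : ℕ) := fun n => by
    have : ∀ᵐ t : ℝ ∂μ, ‖g (n + 1) * (t : ℂ) ^ n‖ = ‖g (n + 1)‖ * t ^ n := by
      filter_upwards [hmem] with t ht
      rw [norm_mul, norm_pow, Complex.norm_real, Real.norm_of_nonneg ht.1.le]
    rw [integral_congr_ae this, integral_const_mul, hpow]
    push_cast
    ring
  have hg1 : Summable fun n : ℕ => ‖g (n + 1)‖ / (n + 1 : ℕ) :=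
    (summable_nat_add_iff (f := fun n : ℕ => ‖g n‖ / (n : ℝ)) 1).2 hg
  have hpt : ∀ t ∈ Set.Ioo (0 : ℝ) 1, (Summable fun n => a n * (φ t ^ n / t)) ∧
      ∑' n, ((a n * (φ t ^ n / t) : ℝ) : ℂ) = ∑' n : ℕ, g (n + 1) * (t : ℂ) ^ n := by
    intro t ht
    have ht' : (t : ℂ) ≠ 0 := by exact_mod_cast ht.1.ne'
    obtain ⟨hp0, hp1⟩ := hφ t ht
    have hs := summable_evalSeq has hp0.le hp1
    constructor
    · rw [← Complex.summable_ofReal]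
      refine (hs.div_const (t : ℂ)).congr fun n => ?_
      push_cast
      ring
    · have h1 := h t ht
      rw [evalSeq, evalSeq, (summable_evalSeq hg ht.1.le ht.2).tsum_eq_zero_add, hg0, zero_mul,
        zero_add] at h1
      calc ∑' n, ((a n * (φ t ^ n / t) : ℝ) : ℂ)
          = (∑' n, (a n : ℂ) * (φ t : ℂ) ^ n) / t := by
            rw [← tsum_div_const]
            refine tsum_congr fun n => ?_
            push_cast
            ring
        _ = _ := by
            rw [h1, ← tsum_div_const]
            refine tsum_congr fun n => ?_
            rw [pow_succ]
            field_simp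
  -- Tonelli for the nonnegative terms: `∑ aₙ cₙ` is the integral of `|∑ gₙ₊₁ tⁿ|`, at most `∑
  -- |gₙ₊₁| / (n + 1)`.
  have hsum : Summable fun n => a n * c n := by
    have hle : ∑' n, ENNReal.ofReal (a n * c n) ≤ ∑' n : ℕ, ENNReal.ofReal (‖g (n + 1)‖ / (n + 1 : ℕ)) := by
      calc ∑' n, ENNReal.ofReal (a n * c n)
          = ∑' n, ∫⁻ t, ENNReal.ofReal (a n * (φ t ^ n / t)) ∂μ := by
            refine tsum_congr fun n => ?_
            rw [← hfc, ofReal_integral_eq_lintegral_ofReal (hfi n) (hf0' n)]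
        _ = ∫⁻ t, ∑' n, ENNReal.ofReal (a n * (φ t ^ n / t)) ∂μ :=
            (lintegral_tsum fun n => (hfi n).aemeasurable.ennreal_ofReal).symm
        _ ≤ ∫⁻ t, ∑' n : ℕ, ‖g (n + 1) * (t : ℂ) ^ n‖ₑ ∂μ := by
            refine lintegral_mono_ae ?_
            filter_upwards [hmem] with t ht
            obtain ⟨hs, he⟩ := hpt t ht
            rw [← ENNReal.ofReal_tsum_of_nonneg (fun n => hf0 n t ht) hs]
            refine le_trans (le_of_eq ?_) enorm_tsum_le_tsum_enorm
            rw [← he, ← Complex.ofReal_tsum, ← ofReal_norm, Complex.norm_real,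
              Real.norm_of_nonneg (tsum_nonneg fun n => hf0 n t ht)]
        _ = ∑' n : ℕ, ∫⁻ t, ‖g (n + 1) * (t : ℂ) ^ n‖ₑ ∂μ :=
            lintegral_tsum fun n => (hFi n).aemeasurable.enorm
        _ = _ := by
            refine tsum_congr fun n => ?_
            rw [← hFn, ofReal_integral_norm_eq_lintegral_enorm (hFi n)]
    have hfin : ∑' n, ENNReal.ofReal (a n * c n) ≠ ⊤ := by
      refine ne_top_of_le_ne_top ?_ hle
      exact hg1.tsum_ofReal_ne_top
    refine (ENNReal.summable_toReal hfin).congr fun n => ?_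
    rw [ENNReal.toReal_ofReal (hac0 n)]
  refine ⟨hsum, ?_⟩
  have e1 := (hasSum_integral_of_summable_integral_norm (μ := μ)
    (F := fun n t => ((a n * (φ t ^ n / t) : ℝ) : ℂ)) (fun n => (hfi n).ofReal) (by
      refine hsum.congr fun n => ?_
      rw [← hfc]
      refine integral_congr_ae ?_
      filter_upwards [hmem] with t ht
      rw [Complex.norm_real, Real.norm_of_nonneg (hf0 n t ht)])).tsum_eq
  have e2 := (hasSum_integral_of_summable_integral_norm (μ := μ)
    (F := fun n (t : ℝ) => g (n + 1) * (t : ℂ) ^ n) hFi (by simpa only [hFn] using hg1)).tsum_eq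
  have e3 : ∫ t, ∑' n, ((a n * (φ t ^ n / t) : ℝ) : ℂ) ∂μ =
      ∫ t : ℝ, ∑' n : ℕ, g (n + 1) * (t : ℂ) ^ n ∂μ := by
    refine integral_congr_ae ?_
    filter_upwards [hmem] with t ht using (hpt t ht).2
  have hg2 : Summable fun n : ℕ => g n / n := Summable.of_norm (by simpa using hg)
  rw [hg2.tsum_eq_zero_add, hg0, zero_div, zero_add, Complex.ofReal_tsum]
  rw [← e3, ← e1] at e2
  simp only [hFc] at e2
  rw [e2]
  refine tsum_congr fun n => ?_
  rw [← hfc, ← integral_complex_ofReal]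

/-! ### The moments of the two substitutions -/

-- The factor `t` in `φ = t ψ` cancels the singularity of `1 / t`, leaving a continuous integrand.
open MeasureTheory in
theorem integrableOn_pow_succ_div {φ ψ : ℝ → ℝ} (hφ : ∀ t, φ t = t * ψ t)
    (hψ : ContinuousOn ψ (Set.Icc 0 1)) (n : ℕ) :
    IntegrableOn (fun t => φ t ^ (n + 1) / t) (Set.Ioo 0 1) ∧
      ∫ t in Set.Ioo (0 : ℝ) 1, φ t ^ (n + 1) / t = ∫ t in (0 : ℝ)..1, φ t ^ n * ψ t := by
  have hφ' : ContinuousOn φ (Set.Icc 0 1) := (continuousOn_id.mul hψ).congr fun t _ => hφ t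
  have hEq : Set.EqOn (fun t => φ t ^ n * ψ t) (fun t => φ t ^ (n + 1) / t) (Set.Ioo 0 1) := by
    intro t ht
    have := ht.1.ne'
    simp only
    rw [pow_succ, hφ t]
    field_simp
  constructor
  · exact ((((hφ'.pow n).mul hψ).integrableOn_Icc).mono_set Set.Ioo_subset_Icc_self).congr_fun hEq
      measurableSet_Ioo
  · rw [intervalIntegral.integral_of_le zero_le_one, integral_Ioc_eq_integral_Ioo,
      setIntegral_congr_fun measurableSet_Ioo hEq]

/-- This is the beta integral `B(n + 1, 1/2)`. With `E = (1 - t) / (1 + t)` one has `E² = 1 - φ`;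
the function `φ ^ (n + 1) * E` vanishes at both endpoints, and its derivative yields `(n + 1) Iₙ =
(n + 3/2) Iₙ₊₁`. -/
theorem integral_four_mul_div_sq_pow (n : ℕ) :
    ∫ t in (0 : ℝ)..1, (4 * t / (1 + t) ^ 2) ^ n * (4 / (1 + t) ^ 2) =
      4 ^ (n + 1) / ((n + 1 : ℕ) * ((2 * (n + 1)).choose (n + 1) : ℝ)) := by
  have hne : ∀ t ∈ Set.uIcc (0 : ℝ) 1, 1 + t ≠ 0 := by
    intro t ht
    rw [Set.uIcc_of_le zero_le_one] at ht
    linarith [ht.1]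
  have hint : ∀ n : ℕ, IntervalIntegrable
      (fun t : ℝ => (4 * t / (1 + t) ^ 2) ^ n * (4 / (1 + t) ^ 2)) MeasureTheory.volume 0 1 := by
    intro n
    refine ContinuousOn.intervalIntegrable ?_
    have := hne
    fun_prop (disch := simp_all)
  induction n with
  | zero =>
    have hd : ∀ t ∈ Set.uIcc (0 : ℝ) 1,
        HasDerivAt (fun t : ℝ => -4 / (1 + t)) ((4 * t / (1 + t) ^ 2) ^ 0 * (4 / (1 + t) ^ 2)) t := by
      intro t ht
      have h := ((hasDerivAt_id t).const_add 1).inv (hne t ht)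
      refine (h.const_mul (-4)).congr_deriv ?_
      simp
      ring
    rw [intervalIntegral.integral_eq_sub_of_hasDerivAt hd (hint 0)]
    norm_num [Nat.choose]
  | succ n ih =>
    have hd : ∀ t ∈ Set.uIcc (0 : ℝ) 1,
        HasDerivAt (fun t : ℝ => (4 * t / (1 + t) ^ 2) ^ (n + 1) * ((1 - t) / (1 + t)))
          ((n + 1) * ((4 * t / (1 + t) ^ 2) ^ n * (4 / (1 + t) ^ 2)) -
            (n + 3 / 2) * ((4 * t / (1 + t) ^ 2) ^ (n + 1) * (4 / (1 + t) ^ 2))) t := by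
      intro t ht
      have h1 := hne t ht
      have hx := (hasDerivAt_id t).const_add 1
      have ha := ((hasDerivAt_id t).const_mul 4).div (hx.pow 2) (pow_ne_zero 2 h1)
      have hb := ((hasDerivAt_id t).const_sub 1).div hx h1
      refine ((ha.pow (n + 1)).mul hb).congr_deriv ?_
      simp only [id, Pi.pow_apply, Pi.div_apply, Nat.add_sub_cancel]
      push_cast
      rw [pow_succ (4 * t / (1 + t) ^ 2) n]
      field_simp
      ring
    have h := intervalIntegral.integral_eq_sub_of_hasDerivAt hd
      (((hint n).const_mul _).sub ((hint (n + 1)).const_mul _))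
    rw [intervalIntegral.integral_sub ((hint n).const_mul _) ((hint (n + 1)).const_mul _),
      intervalIntegral.integral_const_mul, intervalIntegral.integral_const_mul, ih] at h
    have hb := Nat.succ_mul_centralBinom_succ (n + 1)
    have hb0 := Nat.centralBinom_pos (n + 1)
    have hb1 := Nat.centralBinom_pos (n + 1 + 1)
    rw [← Nat.centralBinom_eq_two_mul_choose] at h ⊢
    have hbR : ((n : ℝ) + 1 + 1) * ((n + 1 + 1).centralBinom : ℝ) =
        2 * (2 * (n + 1) + 1) * ((n + 1).centralBinom : ℝ) := by exact_mod_cast hb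
    have hb0' : ((n + 1).centralBinom : ℝ) ≠ 0 := by exact_mod_cast hb0.ne'
    have hb1' : ((n + 1 + 1).centralBinom : ℝ) ≠ 0 := by exact_mod_cast hb1.ne'
    have hn : (n : ℝ) + 1 ≠ 0 := by positivity
    have hn3 : (n : ℝ) + 3 / 2 ≠ 0 := by positivity
    norm_num at h
    rw [sub_eq_zero] at h
    refine mul_left_cancel₀ hn3 (h.symm.trans ?_)
    push_cast
    rw [hbR, pow_succ 4 (n + 1)]
    field_simp
    ring

/-- With `t = tan(θ/2)` this is Wallis' integral of `sin ^ (2n) θ` over `[0, π/2]`. The boundary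
function below is `sin ^ (2n + 1) θ * cos θ`, giving `(2n + 1) Iₙ = (2n + 2) Iₙ₊₁`. -/
theorem integral_two_mul_div_sq_pow (n : ℕ) :
    ∫ t in (0 : ℝ)..1, (2 * t / (1 + t ^ 2)) ^ (2 * n) * (2 / (1 + t ^ 2)) =
      Real.pi / 2 * ((2 * n).choose n : ℝ) / 4 ^ n := by
  have hne : ∀ t : ℝ, 1 + t ^ 2 ≠ 0 := fun t => by positivity
  have hint : ∀ n : ℕ, IntervalIntegrable
      (fun t : ℝ => (2 * t / (1 + t ^ 2)) ^ n * (2 / (1 + t ^ 2))) MeasureTheory.volume 0 1 := by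
    intro n
    refine Continuous.intervalIntegrable ?_ _ _
    fun_prop (disch := simp_all)
  induction n with
  | zero =>
    have hd : ∀ t ∈ Set.uIcc (0 : ℝ) 1, HasDerivAt (fun t : ℝ => 2 * Real.arctan t)
        ((2 * t / (1 + t ^ 2)) ^ 0 * (2 / (1 + t ^ 2))) t := by
      intro t _
      refine ((Real.hasDerivAt_arctan t).const_mul 2).congr_deriv ?_
      ring
    rw [mul_zero, intervalIntegral.integral_eq_sub_of_hasDerivAt hd (hint 0)]
    simp
    ring
  | succ n ih =>
    have hd : ∀ t ∈ Set.uIcc (0 : ℝ) 1,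
        HasDerivAt (fun t : ℝ => (2 * t / (1 + t ^ 2)) ^ (2 * n + 1) * ((1 - t ^ 2) / (1 + t ^ 2)))
          ((2 * n + 1) * ((2 * t / (1 + t ^ 2)) ^ (2 * n) * (2 / (1 + t ^ 2))) -
            (2 * n + 2) * ((2 * t / (1 + t ^ 2)) ^ (2 * n + 2) * (2 / (1 + t ^ 2)))) t := by
      intro t _
      have h1 := hne t
      have hx := ((hasDerivAt_id t).pow 2).const_add 1
      have hx' := ((hasDerivAt_id t).pow 2).const_sub 1
      have ha := ((hasDerivAt_id t).const_mul 2).div hx h1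
      have hb := hx'.div hx h1
      refine ((ha.pow (2 * n + 1)).mul hb).congr_deriv ?_
      simp only [id, Pi.pow_apply, Pi.div_apply, Nat.add_sub_cancel]
      push_cast
      rw [pow_succ (2 * t / (1 + t ^ 2)) (2 * n), pow_add (2 * t / (1 + t ^ 2)) (2 * n) 2]
      field_simp
      ring
    have h := intervalIntegral.integral_eq_sub_of_hasDerivAt hd
      (((hint (2 * n)).const_mul _).sub ((hint (2 * n + 2)).const_mul _))
    rw [intervalIntegral.integral_sub ((hint _).const_mul _) ((hint _).const_mul _),
      intervalIntegral.integral_const_mul, intervalIntegral.integral_const_mul, ih] at h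
    have hb := Nat.succ_mul_centralBinom_succ n
    rw [← Nat.centralBinom_eq_two_mul_choose] at h ⊢
    have hbR : ((n : ℝ) + 1) * ((n + 1).centralBinom : ℝ) =
        2 * (2 * n + 1) * (n.centralBinom : ℝ) := by exact_mod_cast hb
    have hn : 2 * (n : ℝ) + 2 ≠ 0 := by positivity
    norm_num at h
    rw [sub_eq_zero] at h
    rw [mul_add, mul_one]
    refine mul_left_cancel₀ hn (h.symm.trans ?_)
    rw [pow_succ 4 n]
    field_simp
    linear_combination -2 * hbR

/-! ### Pullback of polylogarithms under the two substitutions -/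

theorem isChangeOfVariables_four_mul_div_sq :
    IsChangeOfVariables (fun t => 4 * t / (1 + t) ^ 2) fun t => (1 - t) / (1 + t) where
  mem_Ioo t ht := by
    have h0 := ht.1
    have h1 := ht.2
    refine ⟨by positivity, (div_lt_one (by positivity)).2 ?_⟩
    nlinarith [mul_pos (sub_pos.2 h1) (sub_pos.2 h1)]
  tendsto := by
    have : ContinuousAt (fun t : ℝ => 4 * t / (1 + t) ^ 2) 0 := by
      fun_prop (disch := norm_num)
    have h := this.tendsto
    norm_num at h
    exact h.mono_left nhdsWithin_le_nhds
  hasDerivAt t ht := by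
    have h0 := ht.1.ne'
    have h1 : 1 + t ≠ 0 := by linarith [ht.1]
    refine (((hasDerivAt_id t).const_mul 4).div (((hasDerivAt_id t).const_add 1).pow 2)
      (pow_ne_zero 2 h1)).congr_deriv ?_
    simp only [id, Pi.pow_apply]
    push_cast
    field_simp
    ring

theorem isChangeOfVariables_two_mul_div_sq :
    IsChangeOfVariables (fun t => 2 * t / (1 + t ^ 2)) fun t => (1 - t ^ 2) / (1 + t ^ 2) where
  mem_Ioo t ht := by
    have h0 := ht.1
    have h1 := ht.2
    refine ⟨by positivity, (div_lt_one (by positivity)).2 ?_⟩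
    nlinarith [mul_pos (sub_pos.2 h1) (sub_pos.2 h1)]
  tendsto := by
    have : ContinuousAt (fun t : ℝ => 2 * t / (1 + t ^ 2)) 0 := by
      fun_prop (disch := norm_num)
    have h := this.tendsto
    norm_num at h
    exact h.mono_left nhdsWithin_le_nhds
  hasDerivAt t ht := by
    have h0 := ht.1.ne'
    have h1 : 1 + t ^ 2 ≠ 0 := by positivity
    refine (((hasDerivAt_id t).const_mul 2).div (((hasDerivAt_id t).pow 2).const_add 1)
      h1).congr_deriv ?_
    simp only [id, Pi.pow_apply]
    push_cast
    field_simp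
    ring

theorem integrateAt_one_coeffSeq (s : List (ℕ × ℂ)) (hs : ∀ p ∈ s, 1 ≤ p.1) :
    integrateAt 1 (coeffSeq s) = coeffSeq ((1, 1) :: s) := by
  cases s with
  | nil => exact integrateAt_nil 1
  | cons p s =>
    obtain ⟨k, z⟩ := p
    rw [integrateAt_cons (η' := 1) (by norm_num) (hs (k, z) (by simp)) z s
      fun p hp => hs p (by simp [hp]), mul_one]

theorem evalSeq_coeffSeq_nil (t : ℝ) : evalSeq (coeffSeq []) t = 1 := by
  rw [evalSeq, tsum_eq_single 0]
  · simp [coeffSeq]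
  · intro n hn; simp [coeffSeq, hn]

/-- Induction on the depth, then on the leading exponent: a new letter of exponent `1` comes from
integrating against `dx/(1-x)`, and each further unit of the exponent from `dx/x`. -/
theorem exists_polylogSpan_two_comp (k : List ℕ) (hk : ∀ a ∈ k, 1 ≤ a) :
    ∃ g ∈ polylogSpan 2 k.sum, ∀ t ∈ Set.Ioo (0 : ℝ) 1,
      evalSeq (coeffSeq (k.map fun a => (a, 1))) (4 * t / (1 + t) ^ 2) = evalSeq g t := by
  induction k with
  | nil =>
    refine ⟨coeffSeq [], coeffSeq_mem_polylogSpan (N := 2) [] (by simp), fun t _ => ?_⟩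
    rw [List.map_nil, evalSeq_coeffSeq_nil, evalSeq_coeffSeq_nil]
  | cons a k ih =>
    obtain ⟨g₀, hg₀, h₀⟩ := ih fun b hb => hk b (by simp [hb])
    have hs1 : ∀ p ∈ k.map fun a => (a, (1 : ℂ)), 1 ≤ p.1 := by
      intro p hp
      obtain ⟨b, hb, rfl⟩ := List.mem_map.1 hp
      exact hk b (by simp [hb])
    have hs2 : ∀ p ∈ k.map fun a => (a, (1 : ℂ)), 1 ≤ p.1 ∧ p.2 ^ 2 = 1 := by
      intro p hp
      refine ⟨hs1 p hp, ?_⟩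
      obtain ⟨b, hb, rfl⟩ := List.mem_map.1 hp
      norm_num
    have hmem : ∀ b : ℕ, 1 ≤ b → coeffSeq ((b, 1) :: k.map fun a => (a, (1 : ℂ))) ∈
        polylogSpan 2 (b + k.sum) := by
      intro b hb
      have := coeffSeq_mem_polylogSpan (N := 2) ((b, 1) :: k.map fun a => (a, (1 : ℂ))) (by
        intro p hp
        rcases List.mem_cons.1 hp with rfl | hp
        · exact ⟨hb, by norm_num⟩
        · exact hs2 p hp)
      convert this using 1
      simp [Function.comp_def]
    have hm1 : ((-1 : ℂ)) ^ 2 = 1 := by norm_num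
    obtain ⟨b, rfl⟩ : ∃ b, a = b + 1 := ⟨a - 1, by have := hk a (by simp); omega⟩
    clear hk
    rw [List.map_cons, List.sum_cons]
    induction b with
    | zero =>
      have hi1 := integrateAt_mem (N := 2) two_ne_zero (η := 1) (by norm_num) hg₀
      have hi2 := integrateAt_mem (N := 2) two_ne_zero hm1 hg₀
      have hI1 := Submodule.smul_mem _ (2 : ℚ) hi1
      have hI2 := Submodule.smul_mem _ (2 : ℚ) hi2
      have hI2' := Submodule.smul_mem _ (-2 : ℚ) hi2
      have hg := add_mem hI1 hI2'
      -- For `x = 4t/(1+t)²`, `dx/(1-x) = 4 dt/((1-t)(1+t)) = 2ω₁ - 2ω₋₁`.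
      refine ⟨(2 : ℚ) • integrateAt 1 g₀ + (-2 : ℚ) • integrateAt (-1) g₀, ?_, ?_⟩
      · convert hg using 1; ring_nf
      refine isChangeOfVariables_four_mul_div_sq.evalSeq_comp
        (summable_norm_div_of_mem two_ne_zero (hmem 1 le_rfl))
        (summable_norm_div_of_mem two_ne_zero hg) ?_ fun t ht => ?_
      · rw [apply_zero_of_mem hg, coeffSeq_cons_zero (by norm_num)]
      have hp := isChangeOfVariables_four_mul_div_sq.mem_Ioo t ht
      have hsk := coeffSeq_mem_polylogSpan (N := 2) _ hs2
      have e1 := evalSeq_natCast_mul_integrateAt (summable_norm_div_of_mem two_ne_zero hsk)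
        (η := 1) (by simp) (by
          rw [integrateAt_one_coeffSeq _ hs1]
          exact summable_norm_div_of_mem two_ne_zero (hmem 1 le_rfl)) hp.1.le hp.2
      rw [integrateAt_one_coeffSeq _ hs1, h₀ t ht] at e1
      rw [evalSeq_natCast_mul_add (summable_norm_div_of_mem two_ne_zero hI1)
        (summable_norm_div_of_mem two_ne_zero hI2') ht.1.le ht.2, evalSeq_natCast_mul_smul,
        evalSeq_natCast_mul_smul,
        evalSeq_natCast_mul_integrateAt (summable_norm_div_of_mem two_ne_zero hg₀) (by simp)
          (summable_norm_div_of_mem two_ne_zero hi1) ht.1.le ht.2,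
        evalSeq_natCast_mul_integrateAt (summable_norm_div_of_mem two_ne_zero hg₀) (by simp)
          (summable_norm_div_of_mem two_ne_zero hi2) ht.1.le ht.2, zero_add, e1]
      have n1 : (1 : ℂ) - t ≠ 0 := by exact_mod_cast (sub_pos.2 ht.2).ne'
      have n2 : (1 : ℂ) + t ≠ 0 := by exact_mod_cast (by linarith [ht.1] : (0 : ℝ) < 1 + t).ne'
      have n3 : (1 : ℂ) - 1 * (4 * t / (1 + t) ^ 2) = (1 - t) ^ 2 / (1 + t) ^ 2 := by
        field_simp; ring
      push_cast
      rw [n3, show (1 : ℂ) - -1 * t = 1 + t by ring, one_mul, one_mul]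
      field_simp
      ring
    | succ b ihb =>
      obtain ⟨g, hg, h⟩ := ihb
      have hg' : g ∈ polylogSpan 2 (b + k.sum + 1) := by convert hg using 1; ring_nf
      have hi1 := integrateZero_mem hg'
      have hi2 := integrateAt_mem (N := 2) two_ne_zero hm1 hg'
      have hI2 := Submodule.smul_mem _ (2 : ℚ) hi2
      have hG := add_mem hi1 hI2
      -- Here `dx/x = dt/t - 2 dt/(1+t) = ω₀ + 2ω₋₁`.
      refine ⟨integrateZero g + (2 : ℚ) • integrateAt (-1) g, ?_, ?_⟩
      · convert hG using 1; ring_nf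
      refine isChangeOfVariables_four_mul_div_sq.evalSeq_comp
        (summable_norm_div_of_mem two_ne_zero (hmem (b + 1 + 1) (by omega)))
        (summable_norm_div_of_mem two_ne_zero hG) ?_ fun t ht => ?_
      · rw [apply_zero_of_mem hG, coeffSeq_cons_zero (by omega)]
      rw [← integrateZero_coeffSeq, evalSeq_natCast_mul_integrateZero
        (coeffSeq_cons_zero (by omega) _ _), h t ht,
        evalSeq_natCast_mul_add (summable_norm_div_of_mem two_ne_zero hi1)
        (summable_norm_div_of_mem two_ne_zero hI2) ht.1.le ht.2, evalSeq_natCast_mul_smul,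
        evalSeq_natCast_mul_integrateZero (apply_zero_of_mem hg'),
        evalSeq_natCast_mul_integrateAt (summable_norm_div_of_mem two_ne_zero hg) (by simp)
          (summable_norm_div_of_mem two_ne_zero hi2) ht.1.le ht.2]
      have n2 : (1 : ℂ) + t ≠ 0 := by exact_mod_cast (by linarith [ht.1] : (0 : ℝ) < 1 + t).ne'
      push_cast
      rw [show (1 : ℂ) - -1 * t = 1 + t by ring]
      field_simp
      ring

/-- The sequence `n ↦ 1 / n ^ l` on the odd numbers, as a combination of polylogarithms. -/
noncomputable def oddSeq (l : ℕ) : ℕ → ℂ :=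
  (1 / 2 : ℚ) • coeffSeq [(l, 1)] + (-1 / 2 : ℚ) • coeffSeq [(l, -1)]

theorem oddSeq_apply (l n : ℕ) :
    oddSeq l n = ((if Odd n then 1 / (n : ℝ) ^ l else 0 : ℝ) : ℂ) := by
  simp only [oddSeq, Pi.add_apply, Pi.smul_apply, Rat.smul_def, coeffSeq, polylogPartialSum]
  split_ifs with h
  · rw [h.neg_one_pow]
    push_cast
    ring
  · rw [(Nat.not_odd_iff_even.1 h).neg_one_pow]
    push_cast
    ring

theorem oddSeq_mem {l : ℕ} (hl : 1 ≤ l) : oddSeq l ∈ polylogSpan 2 l := by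
  have h : ∀ z : ℂ, z ^ 2 = 1 → coeffSeq [(l, z)] ∈ polylogSpan 2 l := fun z hz => by
    simpa using coeffSeq_mem_polylogSpan (N := 2) [(l, z)] fun p hp => by
      rw [List.mem_singleton.1 hp]; exact ⟨hl, hz⟩
  exact add_mem (Submodule.smul_mem _ _ (h 1 (by norm_num)))
    (Submodule.smul_mem _ _ (h (-1) (by norm_num)))

theorem integrateZero_oddSeq (l : ℕ) : integrateZero (oddSeq l) = oddSeq (l + 1) := by
  rw [oddSeq, map_add, map_smul, map_smul, integrateZero_coeffSeq, integrateZero_coeffSeq, oddSeq]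

theorem exists_polylogSpan_four_comp {l : ℕ} (hl : 1 ≤ l) :
    ∃ g ∈ polylogSpan 4 l, ∀ t ∈ Set.Ioo (0 : ℝ) 1,
      evalSeq (oddSeq l) (2 * t / (1 + t ^ 2)) = evalSeq g t := by
  have h4 : (4 : ℕ) ≠ 0 := by norm_num
  have hI : Complex.I ^ 4 = 1 := Complex.I_pow_four
  have hI' : (-Complex.I) ^ 4 = 1 := by rw [neg_pow, hI]; norm_num
  have hodd0 : ∀ l, oddSeq l 0 = 0 := fun l => by simp [oddSeq_apply]
  obtain ⟨l, rfl⟩ : ∃ k, l = k + 1 := ⟨l - 1, by omega⟩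
  clear hl
  induction l with
  | zero =>
    have hδ : ∀ N, coeffSeq [] ∈ polylogSpan N 0 := fun N =>
      coeffSeq_mem_polylogSpan (N := N) [] (by simp)
    have hδs := summable_norm_div_of_mem h4 (hδ 4)
    have hsm : ∀ (c : ℚ) {N : ℕ} {z : ℂ}, N ≠ 0 → z ^ N = 1 →
        c • integrateAt z (coeffSeq []) ∈ polylogSpan N (0 + 1) := fun c _ _ hN hz =>
      Submodule.smul_mem _ _ (integrateAt_mem hN hz (hδ _))
    have hs : ∀ (c : ℚ) {z : ℂ}, z ^ 4 = 1 →
        Summable fun n : ℕ => ‖(c • integrateAt z (coeffSeq [])) n‖ / n := fun c _ hz =>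
      summable_norm_div_of_mem h4 (hsm c h4 hz)
    have hs' : ∀ {z : ℂ}, z ^ 4 = 1 →
        Summable fun n : ℕ => ‖integrateAt z (coeffSeq []) n‖ / n := fun hz =>
      summable_norm_div_of_mem h4 (integrateAt_mem h4 hz (hδ _))
    have h1 : (1 : ℂ) ^ 4 = 1 := by norm_num
    have hm1 : (-1 : ℂ) ^ 4 = 1 := by norm_num
    have heval : ∀ (c d : ℚ) {t : ℝ}, t ∈ Set.Ioo (0 : ℝ) 1 →
        evalSeq (fun n => n * (c • integrateAt 1 (coeffSeq []) +
          d • integrateAt (-1) (coeffSeq [])) n) t = c * (t / (1 - t)) - d * (t / (1 + t)) := by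
      intro c d t ht
      rw [evalSeq_natCast_mul_add (hs c h1) (hs d hm1) ht.1.le ht.2, evalSeq_natCast_mul_smul,
        evalSeq_natCast_mul_smul,
        evalSeq_natCast_mul_integrateAt hδs (by simp) (hs' h1) ht.1.le ht.2,
        evalSeq_natCast_mul_integrateAt hδs (by simp) (hs' hm1) ht.1.le ht.2, evalSeq_coeffSeq_nil,
        show (1 : ℂ) - -1 * t = 1 + t by ring]
      ring
    have hodd : oddSeq (0 + 1) = (1 / 2 : ℚ) • integrateAt 1 (coeffSeq []) +
        (-1 / 2 : ℚ) • integrateAt (-1) (coeffSeq []) := by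
      rw [integrateAt_nil, integrateAt_nil, oddSeq, zero_add]
    -- `oddSeq 1` is the series of `artanh`, and `artanh(2t/(1+t²)) = 2 artanh t`: the coefficients
    -- `±1/2` become `±1`.
    have hg := add_mem (hsm 1 h4 h1) (hsm (-1) h4 hm1)
    refine ⟨_, hg, isChangeOfVariables_two_mul_div_sq.evalSeq_comp
      (summable_norm_div_of_mem two_ne_zero (oddSeq_mem le_rfl))
      (summable_norm_div_of_mem h4 hg) ?_ fun t ht => ?_⟩
    · rw [apply_zero_of_mem hg, hodd0]
    · have hp := isChangeOfVariables_two_mul_div_sq.mem_Ioo t ht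
      rw [hodd, heval _ _ hp, heval _ _ ht]
      have n1 : (1 : ℂ) - t ≠ 0 := by exact_mod_cast (sub_pos.2 ht.2).ne'
      have n2 : (1 : ℂ) + t ≠ 0 := by exact_mod_cast (by linarith [ht.1] : (0 : ℝ) < 1 + t).ne'
      have n3 : (1 : ℂ) + t ^ 2 ≠ 0 := by exact_mod_cast (by positivity : (0 : ℝ) < 1 + t ^ 2).ne'
      have n4 : (1 : ℂ) - 2 * t / (1 + t ^ 2) = (1 - t) ^ 2 / (1 + t ^ 2) := by field_simp; ring
      have n5 : (1 : ℂ) + 2 * t / (1 + t ^ 2) = (1 + t) ^ 2 / (1 + t ^ 2) := by field_simp; ring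
      push_cast
      rw [n4, n5]
      field_simp
      ring
  | succ l ih =>
    obtain ⟨g, hg, h⟩ := ih
    have hgs := summable_norm_div_of_mem h4 hg
    have hi0 := integrateZero_mem hg
    have hi1 := integrateAt_mem h4 hI hg
    have hi2 := integrateAt_mem h4 hI' hg
    -- For `x = 2t/(1+t²)`, `dx/x = dt/t - 2t dt/(1+t²) = ω₀ + ω_i + ω₋ᵢ`; this is where level 4
    -- enters.
    have hG := add_mem hi0 (add_mem hi1 hi2)
    refine ⟨_, hG, isChangeOfVariables_two_mul_div_sq.evalSeq_comp
      (summable_norm_div_of_mem two_ne_zero (oddSeq_mem (by omega)))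
      (summable_norm_div_of_mem h4 hG) ?_ fun t ht => ?_⟩
    · rw [apply_zero_of_mem hG, hodd0]
    · rw [← integrateZero_oddSeq, evalSeq_natCast_mul_integrateZero (hodd0 _), h t ht,
        evalSeq_natCast_mul_add (summable_norm_div_of_mem h4 hi0)
          (summable_norm_div_of_mem h4 (add_mem hi1 hi2)) ht.1.le ht.2,
        evalSeq_natCast_mul_add (summable_norm_div_of_mem h4 hi1)
          (summable_norm_div_of_mem h4 hi2) ht.1.le ht.2,
        evalSeq_natCast_mul_integrateZero (apply_zero_of_mem hg),
        evalSeq_natCast_mul_integrateAt hgs (by simp) (summable_norm_div_of_mem h4 hi1) ht.1.le ht.2,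
        evalSeq_natCast_mul_integrateAt hgs (by simp) (summable_norm_div_of_mem h4 hi2) ht.1.le ht.2]
      have n3 : (1 : ℂ) + t ^ 2 ≠ 0 := by exact_mod_cast (by positivity : (0 : ℝ) < 1 + t ^ 2).ne'
      have n4 : ((1 : ℂ) - Complex.I * t) * (1 - -Complex.I * t) = 1 + t ^ 2 := by
        linear_combination -(t : ℂ) ^ 2 * Complex.I_sq
      have n5 : (1 : ℂ) - Complex.I * t ≠ 0 := left_ne_zero_of_mul (n4 ▸ n3)
      have n6 : (1 : ℂ) - -Complex.I * t ≠ 0 := right_ne_zero_of_mul (n4 ▸ n3)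
      have n7 : Complex.I * t / (1 - Complex.I * t) + -Complex.I * t / (1 - -Complex.I * t) =
          -2 * t ^ 2 / (1 + t ^ 2) := by
        rw [div_add_div _ _ n5 n6, n4]
        congr 1
        linear_combination 2 * (t : ℂ) ^ 2 * Complex.I_sq
      rw [← add_mul, n7]
      push_cast
      field_simp
      ring

/-! ### The two series -/

theorem ofReal_multipleHarmonicSum (M : ℕ) (k : List ℕ) :
    (multipleHarmonicSum M k : ℂ) = polylogPartialSum M (k.map fun a => (a, 1)) := by
  induction k generalizing M with
  | nil => simp [multipleHarmonicSum, polylogPartialSum]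
  | cons a k ih => simp [multipleHarmonicSum, polylogPartialSum, ih]

theorem multipleHarmonicSum_nonneg (M : ℕ) (k : List ℕ) : 0 ≤ multipleHarmonicSum M k := by
  induction k generalizing M with
  | nil => simp [multipleHarmonicSum]
  | cons a k ih =>
    exact Finset.sum_nonneg fun n _ => mul_nonneg (by positivity) (ih _)

theorem sum_four_pow_div_centralBinom_mem_CMZV {l : ℕ} (hl : 2 ≤ l) (k : List ℕ)
    (hk : ∀ a ∈ k, 1 ≤ a) :
    Summable (fun n : ℕ => (4 : ℝ) ^ (n + 1) * multipleHarmonicSum n k /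
        (((n + 1 : ℕ) : ℝ) ^ l * ((2 * (n + 1)).choose (n + 1) : ℝ))) ∧
      ((∑' n : ℕ, (4 : ℝ) ^ (n + 1) * multipleHarmonicSum n k /
        (((n + 1 : ℕ) : ℝ) ^ l * ((2 * (n + 1)).choose (n + 1) : ℝ)) : ℝ) : ℂ) ∈
          CMZV 2 (k.sum + l) := by
  obtain ⟨l, rfl⟩ : ∃ m, l = m + 2 := ⟨l - 2, by omega⟩
  have hk' : ∀ a ∈ (l + 1) :: k, 1 ≤ a := by
    intro a ha
    rcases List.mem_cons.1 ha with rfl | ha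
    · omega
    · exact hk a ha
  obtain ⟨g, hg, h⟩ := exists_polylogSpan_two_comp _ hk'
  have hg' : g ∈ polylogSpan 2 (k.sum + l + 1) := by
    convert hg using 1
    simp
    ring_nf
  -- One factor `1 / n` of the summand belongs to the moment `c n`, so `a` carries an exponent one
  -- lower than the series.
  set a : ℕ → ℝ := fun n => 1 / (n : ℝ) ^ (l + 1) * multipleHarmonicSum (n - 1) k with ha
  set c : ℕ → ℝ := fun n => 4 ^ n / (n * ((2 * n).choose n : ℝ)) with hc
  have hac : (fun n => (a n : ℂ)) = coeffSeq (((l + 1) :: k).map fun a => (a, 1)) := by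
    ext n
    simp [ha, coeffSeq, ofReal_multipleHarmonicSum]
  have ha0 : a 0 = 0 := by simp [ha]
  have hmem := coeffSeq_mem_polylogSpan (N := 2) (((l + 1) :: k).map fun a => (a, (1 : ℂ))) (by
    intro p hp
    obtain ⟨b, hb, rfl⟩ := List.mem_map.1 hp
    exact ⟨hk' b hb, by norm_num⟩)
  rw [← hac] at hmem h
  obtain ⟨hs, ht⟩ := summable_and_tsum_eq_of_evalSeq_comp (a := a) (c := c)
    isChangeOfVariables_four_mul_div_sq.mem_Ioo
    (fun n => mul_nonneg (by positivity) (multipleHarmonicSum_nonneg _ _))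
    (summable_norm_div_of_mem two_ne_zero hmem) (summable_norm_div_of_mem two_ne_zero hg')
    (apply_zero_of_mem hg') h (by
      intro n hn
      obtain ⟨m, rfl⟩ : ∃ m, n = m + 1 :=
        Nat.exists_eq_succ_of_ne_zero (by rintro rfl; exact hn ha0)
      have hψ : ContinuousOn (fun t : ℝ => 4 / (1 + t) ^ 2) (Set.Icc 0 1) := by
        have : ∀ t ∈ Set.Icc (0 : ℝ) 1, 1 + t ≠ 0 := fun t ht => by linarith [ht.1]
        fun_prop (disch := simp_all)
      have := integrableOn_pow_succ_div (φ := fun t => 4 * t / (1 + t) ^ 2) (fun t => by ring) hψ m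
      exact ⟨this.1, this.2.trans (integral_four_mul_div_sq_pow m)⟩)
  have hterm : ∀ n : ℕ, (4 : ℝ) ^ (n + 1) * multipleHarmonicSum n k /
      (((n + 1 : ℕ) : ℝ) ^ (l + 2) * ((2 * (n + 1)).choose (n + 1) : ℝ)) =
      a (n + 1) * c (n + 1) := by
    intro n
    simp only [ha, hc, Nat.add_sub_cancel]
    rw [pow_succ ((n + 1 : ℕ) : ℝ) (l + 1)]
    field_simp
  simp only [hterm]
  refine ⟨(summable_nat_add_iff (f := fun n => a n * c n) 1).2 hs, ?_⟩
  have := hs.tsum_eq_zero_add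
  rw [ha0, zero_mul, zero_add] at this
  rw [← this, ht]
  exact tsum_div_mem_CMZV two_ne_zero hg'

theorem sum_pi_mul_centralBinom_mem_CMZV {l : ℕ} (hl : 1 ≤ l) :
    Summable (fun n : ℕ => Real.pi * ((2 * n).choose n : ℝ) /
        ((4 : ℝ) ^ n * (2 * (n : ℝ) + 1) ^ l)) ∧
      ((∑' n : ℕ, Real.pi * ((2 * n).choose n : ℝ) /
        ((4 : ℝ) ^ n * (2 * (n : ℝ) + 1) ^ l) : ℝ) : ℂ) ∈ CMZV 4 (l + 1) := by
  have h4 : (4 : ℕ) ≠ 0 := by norm_num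
  obtain ⟨g, hg, h⟩ := exists_polylogSpan_four_comp hl
  obtain ⟨l, rfl⟩ : ∃ k, l = k + 1 := ⟨l - 1, by omega⟩
  set a : ℕ → ℝ := fun n => if Odd n then 1 / (n : ℝ) ^ (l + 1) else 0 with ha
  -- Only odd `n = 2m + 1` matter, where `n / 2 = m`. The factor `π / 2` accounts for the `2` in
  -- `hterm`.
  set c : ℕ → ℝ := fun n => Real.pi / 2 * ((2 * (n / 2)).choose (n / 2) : ℝ) / 4 ^ (n / 2) with hc
  have hac : oddSeq (l + 1) = fun n => (a n : ℂ) := funext fun n => oddSeq_apply _ _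
  have hmem := oddSeq_mem hl
  rw [hac] at hmem h
  obtain ⟨hs, ht⟩ := summable_and_tsum_eq_of_evalSeq_comp (a := a) (c := c)
    isChangeOfVariables_two_mul_div_sq.mem_Ioo
    (fun n => by simp only [ha]; split_ifs <;> positivity)
    (summable_norm_div_of_mem two_ne_zero hmem) (summable_norm_div_of_mem h4 hg)
    (apply_zero_of_mem hg) h (by
      intro n hn
      have hodd : Odd n := by
        by_contra hno
        simp [ha, hno] at hn
      obtain ⟨m, rfl⟩ := hodd
      have hψ : ContinuousOn (fun t : ℝ => 2 / (1 + t ^ 2)) (Set.Icc 0 1) := by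
        have : ∀ t : ℝ, 1 + t ^ 2 ≠ 0 := fun t => by positivity
        fun_prop (disch := simp_all)
      have := integrableOn_pow_succ_div (φ := fun t => 2 * t / (1 + t ^ 2)) (fun t => by ring) hψ
        (2 * m)
      refine ⟨this.1, this.2.trans ((integral_two_mul_div_sq_pow m).trans ?_)⟩
      simp only [hc, show (2 * m + 1) / 2 = m by omega])
  have hinj : Function.Injective fun n : ℕ => 2 * n + 1 := fun m n hmn => by
    simp only at hmn
    omega
  have hterm : ∀ n : ℕ, Real.pi * ((2 * n).choose n : ℝ) /
      ((4 : ℝ) ^ n * (2 * (n : ℝ) + 1) ^ (l + 1)) = 2 * (a (2 * n + 1) * c (2 * n + 1)) := by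
    intro n
    simp only [ha, hc, show (2 * n + 1) / 2 = n by omega, if_pos (odd_two_mul_add_one n)]
    push_cast
    field_simp
  simp only [hterm]
  refine ⟨(hs.comp_injective hinj).mul_left 2, ?_⟩
  have hsupp : Function.support (fun n => a n * c n) ⊆ Set.range fun n : ℕ => 2 * n + 1 := by
    intro n hn
    by_cases hodd : Odd n
    · obtain ⟨m, rfl⟩ := hodd
      exact ⟨m, rfl⟩
    · simp [ha, hodd] at hn
  rw [tsum_mul_left, hinj.tsum_eq hsupp, Complex.ofReal_mul, ht]
  have := Submodule.smul_mem _ (2 : ℚ) (tsum_div_mem_CMZV h4 hg)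
  rw [Algebra.smul_def] at this
  simpa using this

theorem mainTheorem5 (l : ℕ) (hl : 2 ≤ l) :
    (∀ k : List ℕ, (∀ a ∈ k, 1 ≤ a) →
      Summable (fun n : ℕ => (4 : ℝ) ^ (n + 1) * multipleHarmonicSum n k /
        (((n + 1 : ℕ) : ℝ) ^ l * ((2 * (n + 1)).choose (n + 1) : ℝ))) ∧
      ((∑' n : ℕ, (4 : ℝ) ^ (n + 1) * multipleHarmonicSum n k /
        (((n + 1 : ℕ) : ℝ) ^ l * ((2 * (n + 1)).choose (n + 1) : ℝ)) : ℝ) : ℂ) ∈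
          CMZV 2 (k.sum + l)) ∧
    (Summable (fun n : ℕ => Real.pi * ((2 * n).choose n : ℝ) /
        ((4 : ℝ) ^ n * (2 * (n : ℝ) + 1) ^ l)) ∧
      ((∑' n : ℕ, Real.pi * ((2 * n).choose n : ℝ) /
        ((4 : ℝ) ^ n * (2 * (n : ℝ) + 1) ^ l) : ℝ) : ℂ) ∈ CMZV 4 (l + 1)) :=
  ⟨fun k hk => sum_four_pow_div_centralBinom_mem_CMZV hl k hk,
    sum_pi_mul_centralBinom_mem_CMZV (by omega)⟩
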